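/- **Setting.** Let $T\ge 0$, let $(\Omega,\mathcal F,\mathbb P)$ be a probability space carrying an $m$-dimensional Brownian motion $W$ and an $n$-dimensional Brownian motion $B$ on $[0,T]$, independent of each other, and let $\mathcal G\subseteq\mathcal F$ be a countably generated $\sigma$-algebra independent of $(W,B)$. Let $\mathbb F^W$, $\mathbb F^B$, $\mathbb F^{W,B}$ be the (non-augmented) generated filtrations. Let $A$ be a Polish space whose topology is given by a metric $\rho<1$. For $s\in[0,T]$ let $\mathcal A_s=L^0(\Omega,\mathcal G\vee\mathcal F^W_s,\mathbb P;A)$ be the set of $\mathbb P$-equivalence classes of $\mathcal G\vee\mathcal F^W_s$-measurable maps $\Omega\to A$, so that $\mathcal A_s\subseteq\mathcal A_T$; $\mathcal A_T$ carries the metric $\hat\rho(\phi,\psi)=\mathbb E[\rho(\phi,\psi)]$ and its Borel $\sigma$-algebra. Let $(\hat\Omega,\hat{\mathcal F},\hat{\mathbb P})$ be an extension of $(\Omega,\mathcal F,\mathbb P)$, i.e. a probability space with a probability preserving map $\pi:\hat\Omega\to\Omega$ (for instance $\hat\Omega=\Omega$, $\pi=\mathrm{id}$); $\sigma$-algebras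 and random variables on $\Omega$ are viewed on $\hat\Omega$ through $\pi$. Let $\mathcal A$ be the set of $\mathbb F^{W,B}\vee\mathcal G$-predictable processes $\alpha:[0,T]\times\hat\Omega\to A$, and $\hat{\mathcal A}$ the set of $\mathbb F^B$-predictable processes $\hat\alpha:[0,T]\times\hat\Omega\to\mathcal A_T$ with $\hat\alpha_s(\hat\omega)\in\mathcal A_s$ for all $(s,\hat\omega)$. Here predictable means measurable with respect to the $\sigma$-algebra generated by the sets $(t,T]\times C$ with $C$ in the filtration at time $t$ and $\{0\}\times C$ with $C$ in the filtration at time $0$. For a filtration $\mathbb F$ on $\hat\Omega$ independent of $(\mathcal G,W)$, an $\mathbb F^W\vee\mathcal G\vee\mathbb F$-progressive process $\alpha:[0,T]\times\hat\Omega\to A$ is said to *$\mathbb F$-identify to* an $\mathbb F$-progressive process $\hat\alpha:[0,T]\times\hat\Omega\to\mathcal A_T$ if there is a $(\mathcal G\vee\mathbb F^W)\otimes\mathbb F$-progressive process $\Phi:[0,T]\times\Omega\times\hat\Omega\to A$ such that for all $(s,\hat\omega)\in[0,T]\times\hat\Omega$ $$\alpha_s(\hat\omega)=\Phi_s(\pi(\hat\omega),\hat\omega)\qquad\text{and}\qquad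 \hat\alpha_s(\hat\omega)=\Phi_s(\cdot,\hat\omega)\ \text{ in }\mathcal A_T .$$ **Statement.** 1. For every $\hat\alpha\in\hat{\mathcal A}$ there exists an $\alpha\in\mathcal A$ that $\mathbb F^B$-identifies to $\hat\alpha$ (in particular $\mathbb F^B$ is independent of $(\mathcal G,W)$, and the two processes are progressive as required). 2. Conversely, for every $\alpha\in\mathcal A$ there exists an $\hat\alpha\in\hat{\mathcal A}$ such that $\alpha$ $\mathbb F^B$-identifies to $\hat\alpha$. 3. If $\alpha^1,\alpha^2\in\mathcal A$ $\mathbb F^B$-identify to $\hat\alpha^1,\hat\alpha^2\in\hat{\mathcal A}$ respectively, then $\alpha^1$ is a modification of $\alpha^2$ (i.e. $\alpha^1_s=\alpha^2_s$ $\hat{\mathbb P}$-a.s. for every $s\in[0,T]$) if and only if $\hat\alpha^1$ is a modification of $\hat\alpha^2$. Consequently, $\mathbb F^B$-identification induces a bijection between $\mathcal A$ and $\hat{\mathcal A}$ up to modification. -/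

import Mathlib

open MeasureTheory ProbabilityTheory
open scoped NNReal ENNReal

namespace MeanFieldControl

/-! ### Time interval and operations on filtrations -/

/-- The time interval `[0,T]`. -/
abbrev TimeInterval (T : ℝ≥0) : Type := Set.Iic T

section Filtrations

variable {ι Ω Ω' : Type*} [Preorder ι] {mΩ : MeasurableSpace Ω} {mΩ' : MeasurableSpace Ω'}

/-- The filtration on `Ω'` of reciprocal images under `π : Ω' → Ω` of a filtration on `Ω`. -/
def pullback (π : Ω' → Ω) (hπ : Measurable π) (𝔽 : Filtration ι mΩ) : Filtration ι mΩ' where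
  seq t := (𝔽 t).comap π
  mono' _ _ hst := MeasurableSpace.comap_mono (𝔽.mono hst)
  le' t := (MeasurableSpace.comap_mono (𝔽.le t)).trans hπ.comap_le

/-- The product filtration `(ℱ_t ⊗ ℋ_t)_t` on `Ω × Ω'`. -/
def prodFiltration (𝔽 : Filtration ι mΩ) (ℍ : Filtration ι mΩ') :
    Filtration ι (mΩ.prod mΩ') where
  seq t := (𝔽 t).prod (ℍ t)
  mono' _ _ hst := sup_le_sup (MeasurableSpace.comap_mono (𝔽.mono hst))
    (MeasurableSpace.comap_mono (ℍ.mono hst))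
  le' t := sup_le_sup (MeasurableSpace.comap_mono (𝔽.le t))
    (MeasurableSpace.comap_mono (ℍ.le t))

/-- A process is predictable if it is measurable with respect to the predictable `σ`-algebra. -/
def IsPredictableProcess [OrderBot ι] {E : Type*} [MeasurableSpace E]
    (𝔽 : Filtration ι mΩ) (u : ι → Ω → E) : Prop :=
  Measurable[𝔽.predictable] (Function.uncurry u)

/-- `u` and `v` are modifications of each other. -/
def IsModification {E : Type*} (P : Measure Ω) (u v : ι → Ω → E) : Prop :=
  ∀ t, u t =ᵐ[P] v t

end Filtrations

/-! ### The spaces `L⁰` -/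

/-- `L⁰(Ω, 𝒢, P; A)`: the `P`-equivalence classes of functions `Ω → A` that have a
`𝒢`-measurable representative. -/
def L0 {Ω : Type*} (𝒢 : MeasurableSpace Ω) {mΩ : MeasurableSpace Ω} (P : Measure Ω)
    (A : Type*) [TopologicalSpace A] : Type _ :=
  {φ : Ω →ₘ[P] A // AEStronglyMeasurable[𝒢] φ P}

namespace L0

variable {Ω : Type*} {𝒢 : MeasurableSpace Ω} {mΩ : MeasurableSpace Ω} {P : Measure Ω}
  {A : Type*}

/-- The distance `E[ρ(φ, ψ)]` on `L⁰`, where `ρ` is the metric of `A`. It is written with values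
in `[0, ∞]`; it is smaller than `1` as soon as `ρ < 1` and `P` is a probability measure. -/
noncomputable instance [MetricSpace A] : EMetricSpace (L0 𝒢 P A) where
  edist φ ψ := ∫⁻ ω, edist (φ.1 ω) (ψ.1 ω) ∂P
  edist_self φ := by simp
  edist_comm φ ψ := by simp only [edist_comm]
  edist_triangle φ ψ χ := by
    rw [← lintegral_add_left' (φ.1.aestronglyMeasurable.edist ψ.1.aestronglyMeasurable)]
    exact lintegral_mono fun ω => edist_triangle _ _ _
  eq_of_edist_eq_zero {φ ψ} h := by
    rw [lintegral_eq_zero_iff'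
      (φ.1.aestronglyMeasurable.edist ψ.1.aestronglyMeasurable)] at h
    refine Subtype.ext (AEEqFun.ext ?_)
    filter_upwards [h] with ω hω
    exact edist_eq_zero.mp hω

/-- `L⁰` carries its Borel `σ`-algebra. -/
noncomputable instance [MetricSpace A] : MeasurableSpace (L0 𝒢 P A) := borel _

instance [MetricSpace A] : BorelSpace (L0 𝒢 P A) := ⟨rfl⟩

end L0

/-! ### Brownian motion and the probabilistic setting -/

/-- `W` is a standard `d`-dimensional Brownian motion on `[0,T]` under `P`. -/
structure IsBrownianMotion {Ω : Type*} {mΩ : MeasurableSpace Ω} {T : ℝ≥0} {d : ℕ}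
    (W : TimeInterval T → Ω → (Fin d → ℝ)) (P : Measure Ω) : Prop where
  measurable : ∀ t, Measurable (W t)
  start_zero : ∀ᵐ ω ∂P, W ⊥ ω = 0
  indep_increments : HasIndepIncrements W P
  law_increment : ∀ s t, s ≤ t →
    P.map (fun ω => W t ω - W s ω) = Measure.pi fun _ : Fin d => gaussianReal 0 (t.1 - s.1)
  continuous_paths : ∀ᵐ ω ∂P, Continuous fun t => W t ω

/-- The filtration generated by a Brownian motion (not augmented by null sets). -/
def IsBrownianMotion.filtration {Ω : Type*} {mΩ : MeasurableSpace Ω} {T : ℝ≥0} {d : ℕ}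
    {W : TimeInterval T → Ω → (Fin d → ℝ)} {P : Measure Ω} (hW : IsBrownianMotion W P) :
    Filtration (TimeInterval T) mΩ :=
  Filtration.natural W fun t => (hW.measurable t).stronglyMeasurable

/-- The probabilistic setting: an `m`-dimensional Brownian motion `W` (idiosyncratic noise), an
independent `n`-dimensional Brownian motion `B` (common noise) and a separable `σ`-algebra `G`
of initial information that is independent of `(W, B)`. -/
structure Setting {Ω : Type*} {mΩ : MeasurableSpace Ω} (P : Measure Ω)
    (T : ℝ≥0) (m n : ℕ) where
  /-- idiosyncratic noise -/
  W : TimeInterval T → Ω → (Fin m → ℝ)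
  /-- common noise -/
  B : TimeInterval T → Ω → (Fin n → ℝ)
  /-- initial information -/
  G : MeasurableSpace Ω
  brownian_W : IsBrownianMotion W P
  brownian_B : IsBrownianMotion B P
  indep_W_B : Indep (brownian_W.filtration ⊤) (brownian_B.filtration ⊤) P
  G_le : G ≤ mΩ
  G_separable : @MeasurableSpace.CountablyGenerated Ω G
  indep_G : Indep G (brownian_W.filtration ⊤ ⊔ brownian_B.filtration ⊤) P

namespace Setting

variable {Ω Ω' : Type*} {mΩ : MeasurableSpace Ω} {mΩ' : MeasurableSpace Ω'}
  {P : Measure Ω} {P' : Measure Ω'} {T : ℝ≥0} {m n : ℕ}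

/-- The filtration `𝔽^B`. -/
def filtB (S : Setting P T m n) : Filtration (TimeInterval T) mΩ := S.brownian_B.filtration

/-- The filtration `𝒢 ∨ 𝔽^W`. -/
def filtGW (S : Setting P T m n) : Filtration (TimeInterval T) mΩ :=
  Filtration.const _ S.G S.G_le ⊔ S.brownian_W.filtration

/-- The space `𝒜_T = L⁰(Ω, 𝒢 ∨ ℱ^W_T, P; A)`. -/
abbrev ActionSpace (S : Setting P T m n) (A : Type*) [TopologicalSpace A] : Type _ :=
  L0 (S.filtGW ⊤) P A

/-- The subset `𝒜_s = L⁰(Ω, 𝒢 ∨ ℱ^W_s, P; A)` of `𝒜_T`. -/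
def actionSubset (S : Setting P T m n) (A : Type*) [TopologicalSpace A] (s : TimeInterval T) :
    Set (S.ActionSpace A) :=
  {φ : S.ActionSpace A | AEStronglyMeasurable[S.filtGW s] φ.1 P}

/-! In the following `(Ω', P')` is an extension of `(Ω, P)`, with probability preserving
projection `π : Ω' → Ω`. Objects on `Ω` are viewed on `Ω'` by composing with `π`; the choice
`Ω' = Ω`, `π = id` is allowed. -/

/-- The set `𝒜` of admissible controls: the `𝔽^{W,B} ∨ 𝒢`-predictable `A`-valued processes. -/
def controls (S : Setting P T m n) (π : Ω' → Ω) (hπ : Measurable π)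
    (A : Type*) [MeasurableSpace A] : Set (TimeInterval T → Ω' → A) :=
  {α | IsPredictableProcess (pullback π hπ (S.filtGW ⊔ S.filtB)) α}

/-- The set `𝒜̂` of reformulated controls: the `𝔽^B`-predictable `𝒜_T`-valued processes `β` with
`β_s ∈ 𝒜_s` for all `s`. -/
def reformulatedControls (S : Setting P T m n) (π : Ω' → Ω) (hπ : Measurable π)
    (A : Type*) [MetricSpace A] : Set (TimeInterval T → Ω' → S.ActionSpace A) :=
  {β | IsPredictableProcess (pullback π hπ S.filtB) β ∧ ∀ s ω', β s ω' ∈ S.actionSubset A s}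

/-- For a filtration `𝔽` on the extension that is independent of `(𝒢, W)`, the
`𝔽^W ∨ 𝒢 ∨ 𝔽`-progressive process `α` `𝔽`-identifies to the `𝔽`-progressive process `β`. -/
structure Identifies (S : Setting P T m n) (π : Ω' → Ω) (hπ : Measurable π)
    {A : Type*} [MetricSpace A] [MeasurableSpace A] (P' : Measure Ω')
    (𝔽 : Filtration (TimeInterval T) mΩ')
    (α : TimeInterval T → Ω' → A) (β : TimeInterval T → Ω' → S.ActionSpace A) : Prop where
  indep : Indep (𝔽 ⊤) (pullback π hπ S.filtGW ⊤) P'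
  progressive_left : IsProgressive (pullback π hπ S.filtGW ⊔ 𝔽) α
  progressive_right : IsProgressive 𝔽 β
  exists_common : ∃ Φ : TimeInterval T → Ω × Ω' → A,
    IsProgressive (prodFiltration S.filtGW 𝔽) Φ ∧
    (∀ s ω', α s ω' = Φ s (π ω', ω')) ∧
    (∀ s ω', (β s ω').1 =ᵐ[P] fun ω => Φ s (ω, ω'))

end Setting

end MeanFieldControl

/-! Everything passes through a common process `Φ` on `[0,T] × Ω × Ω'`, predictable for the product
of `𝒢 ∨ 𝔽^W` and `𝔽^B`: substituting `ω = π ω'` gives `α`, and taking the class of `Φ_s(·, ω')`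
gives `β`.

From `β` to `α`, one needs a representative of `φ ∈ 𝒜_s` that is jointly measurable in `φ`, `s` and
`ω`. Encode `A` injectively by a bounded function `f`. Then `f(φ)` is the density of the measure
`f(φ) P`, which depends measurably on `φ`, and densities of kernels have jointly measurable versions
over a countably generated `σ`-algebra (`exists_measurable_representative`). The natural filtration
involves uncountably many `W_r`, so the predictable `σ`-algebra is replaced by its sub-`σ`-algebra
`strictPast`, built from countably many times. Path continuity shows that its section at `s`
recovers `𝒢 ∨ ℱ^W_s` up to null sets (`exists_strictPast_ae_eq`).

From `α` to `β`, the graph map `ω' ↦ (π ω', ω')` generates enough sets for `α` to factor through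
some `Φ` (`predictable_le_comap_graph` and Doob–Dynkin). Predictability of `β` is then measurability
of an `L⁰`-valued section map (`L0.stronglyMeasurable_of_ae_eq_section`).

For modifications, independence and Fubini show that `Φ¹_s = Φ²_s` almost surely on the graph if and
only if, for almost every `ω'`, it holds for almost every `ω`, that is, the classes agree
(`ae_graph_iff_of_indep`). -/

namespace MeanFieldControl

open Filter Topology MeasurableSpace

/-! ### Measurable dependence of laws and weighted measures on `φ ∈ L⁰`. -/

namespace L0

variable {Ω : Type*} {𝒢 : MeasurableSpace Ω} {mΩ : MeasurableSpace Ω} {P : Measure Ω}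
  {A : Type*} [MetricSpace A]

lemma edist_def (φ ψ : L0 𝒢 P A) : edist φ ψ = ∫⁻ ω, edist (φ.1 ω) (ψ.1 ω) ∂P := rfl

/-- The integral of a Lipschitz function of `φ` over a fixed set is continuous in `φ`. -/
lemma continuous_setLIntegral_of_le_add {f : A → ℝ≥0∞} (K : ℝ≥0∞) (hK : K ≠ ∞)
    (hf : ∀ x y, f x ≤ f y + K * edist x y) (C : Set Ω) :
    Continuous fun φ : L0 𝒢 P A => ∫⁻ ω in C, f (φ.1 ω) ∂P := by
  refine continuous_of_le_add_edist K hK fun φ ψ => ?_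
  calc ∫⁻ ω in C, f (φ.1 ω) ∂P
      ≤ ∫⁻ ω in C, (f (ψ.1 ω) + K * edist (φ.1 ω) (ψ.1 ω)) ∂P :=
        lintegral_mono fun ω => hf _ _
    _ = ∫⁻ ω in C, f (ψ.1 ω) ∂P + K * ∫⁻ ω in C, edist (φ.1 ω) (ψ.1 ω) ∂P := by
        have hm : AEMeasurable (fun ω => edist (φ.1 ω) (ψ.1 ω)) (P.restrict C) :=
          (φ.1.aestronglyMeasurable.edist ψ.1.aestronglyMeasurable).restrict
        rw [lintegral_add_right' _ (hm.const_mul K), lintegral_const_mul' _ _ hK]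
    _ ≤ _ := by
        gcongr
        exact setLIntegral_le_lintegral _ _

lemma measurable_measure_inter_preimage_of_isOpen [MeasurableSpace A] [BorelSpace A]
    {U : Set A} (hU : IsOpen U) (C : Set Ω) :
    Measurable fun φ : L0 𝒢 P A => P.restrict C (φ.1 ⁻¹' U) := by
  -- These functions are `k`-Lipschitz and increase to the indicator of the open set `U`, so the
  -- measure is a countable supremum of continuous functions of `φ`.
  let f : ℕ → A → ℝ≥0∞ := fun k x => min 1 (k * Metric.infEDist x Uᶜ)
  have hfm (k : ℕ) : Measurable (f k) :=
    measurable_const.min (measurable_infEDist.const_mul _)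
  have hmono : Monotone f := fun k l hkl x => by
    have : (k : ℝ≥0∞) ≤ l := by exact_mod_cast hkl
    exact min_le_min le_rfl (by gcongr)
  have hsup (x : A) : ⨆ k, f k x = U.indicator 1 x := by
    by_cases hx : x ∈ U
    · have h0 : Metric.infEDist x Uᶜ ≠ 0 := fun h => by
        have := Metric.mem_closure_iff_infEDist_zero.2 h
        rw [hU.isClosed_compl.closure_eq] at this
        exact this hx
      refine le_antisymm (iSup_le fun k => by simp [f, hx]) ?_
      obtain ⟨k, hk⟩ := ENNReal.exists_nat_mul_gt h0 (b := 1) ENNReal.one_ne_top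
      refine le_trans ?_ (le_iSup _ k)
      simp [f, hx, hk.le]
    · have h0 : Metric.infEDist x Uᶜ = 0 := Metric.infEDist_zero_of_mem hx
      simp [f, h0, hx]
  have hint (φ : L0 𝒢 P A) :
      P.restrict C (φ.1 ⁻¹' U) = ⨆ k, ∫⁻ ω in C, f k (φ.1 ω) ∂P := by
    have hφ : Measurable (φ.1 : Ω → A) := φ.1.measurable
    refine Eq.trans ?_ (lintegral_iSup (f := fun k ω => f k (φ.1 ω))
      (fun k => (hfm k).comp hφ) fun k l hkl ω => hmono hkl _)
    rw [← lintegral_indicator_one (hφ hU.measurableSet)]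
    refine lintegral_congr fun ω => ?_
    rw [hsup]
    rfl
  simp_rw [hint]
  refine Measurable.iSup fun k => Continuous.measurable ?_
  refine continuous_setLIntegral_of_le_add (k : ℝ≥0∞) (ENNReal.natCast_ne_top k) (fun x y => ?_) C
  calc f k x ≤ min 1 (k * Metric.infEDist y Uᶜ + k * edist x y) := by
        rw [← mul_add]
        exact min_le_min le_rfl (by gcongr; exact Metric.infEDist_le_infEDist_add_edist)
    _ ≤ _ := by
        rw [min_le_iff]
        by_cases h : 1 ≤ (k : ℝ≥0∞) * Metric.infEDist y Uᶜ
        · left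
          simp [f, h]
        · right
          simp [f, (not_le.1 h).le]

/-- The restricted law of `φ` depends measurably on `φ`. -/
lemma measurable_map_restrict [MeasurableSpace A] [BorelSpace A] [IsFiniteMeasure P]
    (C : Set Ω) :
    Measurable fun φ : L0 𝒢 P A => (P.restrict C).map φ.1 := by
  refine Measurable.measure_of_isPiSystem (S := {U : Set A | IsOpen U})
    (BorelSpace.measurable_eq) isPiSystem_isOpen (fun U hU => ?_) ?_
  · simp_rw [fun φ : L0 𝒢 P A => Measure.map_apply (μ := P.restrict C) φ.1.measurable
      (IsOpen.measurableSet hU)]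
    exact measurable_measure_inter_preimage_of_isOpen hU C
  · simp_rw [fun φ : L0 𝒢 P A => Measure.map_apply (μ := P.restrict C) φ.1.measurable
      MeasurableSet.univ]
    exact measurable_measure_inter_preimage_of_isOpen isOpen_univ C

/-- The mass of a set `C` is the integral of `f` against the law of `φ` restricted to `C`. This
makes `φ ↦ f(φ) P` a kernel, to which differentiation of kernels applies. -/
lemma measurable_withDensity [MeasurableSpace A] [BorelSpace A] [IsFiniteMeasure P]
    {f : A → ℝ≥0∞} (hf : Measurable f) :
    Measurable fun φ : L0 𝒢 P A => P.withDensity fun ω => f (φ.1 ω) := by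
  refine Measure.measurable_of_measurable_coe _ fun C hC => ?_
  have (φ : L0 𝒢 P A) : (P.withDensity fun ω => f (φ.1 ω)) C =
      ∫⁻ a, f a ∂((P.restrict C).map φ.1) := by
    rw [withDensity_apply _ hC, lintegral_map hf φ.1.measurable]
  simp_rw [this]
  exact (Measure.measurable_lintegral hf).comp (measurable_map_restrict C)

end L0

/-! ### Jointly measurable representatives through densities of kernels. -/

/-- If every set of `𝒢` coincides almost everywhere with the preimage under `g` of a measurable
set, then every `𝒢`-measurable function coincides almost everywhere with a measurable function of
`g`. -/
lemma exists_measurable_comp_ae_eq {Ω Γ : Type*} {𝒢 mΩ : MeasurableSpace Ω} [MeasurableSpace Γ]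
    {P : Measure Ω} {g : Ω → Γ}
    (hg : ∀ C, MeasurableSet[𝒢] C → ∃ D, MeasurableSet D ∧ C =ᵐ[P] g ⁻¹' D)
    {f : Ω → ℝ≥0∞} (hf : Measurable[𝒢] f) :
    ∃ h : Γ → ℝ≥0∞, Measurable h ∧ f =ᵐ[P] h ∘ g := by
  refine Measurable.ennreal_induction
    (motive := fun f => ∃ h : Γ → ℝ≥0∞, Measurable h ∧ f =ᵐ[P] h ∘ g) ?_ ?_ ?_ hf
  · intro c C hC
    obtain ⟨D, hD, hCD⟩ := hg C hC
    refine ⟨D.indicator fun _ => c, measurable_const.indicator hD, ?_⟩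
    have := indicator_ae_eq_of_ae_eq_set (f := fun _ : Ω => c) hCD
    exact this
  · rintro f₁ f₂ - - - ⟨h₁, hm₁, he₁⟩ ⟨h₂, hm₂, he₂⟩
    refine ⟨h₁ + h₂, hm₁.add hm₂, ?_⟩
    filter_upwards [he₁, he₂] with ω h h'
    simp [h, h']
  · intro f _ _ ih
    choose h hm he using ih
    refine ⟨fun x => ⨆ n, h n x, Measurable.iSup hm, ?_⟩
    filter_upwards [ae_all_iff.2 he] with ω hω
    simp [hω]

/-- A jointly measurable choice of representatives: on a countably generated space `Γ` over
`I × Ω`, there is a measurable function `Ψ` of `φ` and the point of `Γ` which, for fixed `s`, is a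
representative of `φ` as soon as `φ` is measurable for the trace of `Γ` at `s`. -/
theorem exists_measurable_representative {I Ω Γ A : Type*} [MeasurableSpace I]
    {𝒢 mΩ : MeasurableSpace Ω} {P : Measure Ω} [IsFiniteMeasure P]
    [MeasurableSpace Γ] [CountablyGenerated Γ]
    [MetricSpace A] [MeasurableSpace A] [BorelSpace A] [StandardBorelSpace A] [Nonempty A]
    {j : I × Ω → Γ} (hj : Measurable j) {p : Γ → I} (hp : Measurable p)
    (hpj : ∀ z, p (j z) = z.1) :
    ∃ Ψ : L0 𝒢 P A × Γ → A, Measurable Ψ ∧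
      ∀ (s : I) (𝒢' : MeasurableSpace Ω),
        (∀ C, MeasurableSet[𝒢'] C → ∃ D, MeasurableSet D ∧ C =ᵐ[P] (fun ω => j (s, ω)) ⁻¹' D) →
        ∀ φ : L0 𝒢 P A, AEStronglyMeasurable[𝒢'] φ.1 P → φ.1 =ᵐ[P] fun ω => Ψ (φ, j (s, ω)) := by
  obtain ⟨e, he⟩ := exists_measurableEmbedding_real A
  -- Since `π / 2 < 2`, the shifted arctangent lies in `(0, 4)`: `ofReal` stays injective and the
  -- weighted measures stay finite.
  let f : A → ℝ≥0∞ := fun a => ENNReal.ofReal (Real.arctan (e a) + 2)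
  have hpos (x : ℝ) : 0 ≤ Real.arctan x + 2 := by
    have := Real.neg_pi_div_two_lt_arctan x
    have := Real.pi_lt_four
    linarith
  have hf : Measurable f :=
    ((Real.measurable_arctan.comp he.measurable).add_const 2).ennreal_ofReal
  have hf4 (a : A) : f a ≤ 4 := by
    have := Real.arctan_lt_pi_div_two (e a)
    have := Real.pi_lt_four
    refine (ENNReal.ofReal_le_ofReal (q := 4) (by linarith)).trans (by simp)
  have hinj : Function.Injective f := fun a b hab => by
    have := (ENNReal.ofReal_eq_ofReal_iff (hpos _) (hpos _)).1 hab
    exact he.injective (Real.arctan_injective (by linarith))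
  -- The decoder: a measurable left inverse of `f`.
  obtain ⟨g, hgm, hg⟩ := (hf.measurableEmbedding hinj).exists_measurable_extend
    (g := (id : A → A)) measurable_id fun _ => inferInstance
  let κ₀ : Kernel (L0 𝒢 P A) Ω := ⟨_, L0.measurable_withDensity (𝒢 := 𝒢) (P := P) hf⟩
  have : IsFiniteKernel κ₀ := ⟨⟨4 * P Set.univ, ENNReal.mul_lt_top (by simp) (measure_lt_top _ _),
    fun φ => by
      change (P.withDensity fun ω => f (φ.1 ω)) Set.univ ≤ _
      rw [withDensity_apply _ MeasurableSet.univ, Measure.restrict_univ, ← lintegral_const]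
      exact lintegral_mono fun ω => hf4 _⟩⟩
  -- `κ (s, φ)` and `η (s, φ)` are the images under `j (s, ·)` of `f(φ) P` and of `P`. If `f(φ)`
  -- equals `h (j (s, ·))` almost everywhere, then `κ (s, φ)` has density `h` with respect to `η (s,
  -- φ)`, so the density read along `j (s, ·)` returns `f(φ)`.
  let κ : Kernel (I × L0 𝒢 P A) Γ :=
    ((Kernel.deterministic Prod.fst measurable_fst) ×ₖ
      (κ₀.comap Prod.snd measurable_snd)).map j
  let η : Kernel (I × L0 𝒢 P A) Γ :=
    ((Kernel.deterministic Prod.fst measurable_fst) ×ₖ (Kernel.const _ P)).map j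
  have hκ (s : I) (φ : L0 𝒢 P A) :
      κ (s, φ) = (P.withDensity fun ω => f (φ.1 ω)).map fun ω => j (s, ω) := by
    change ((Kernel.deterministic Prod.fst measurable_fst) ×ₖ
      (κ₀.comap Prod.snd measurable_snd)).map j (s, φ) = _
    rw [Kernel.map_apply _ hj, Kernel.prod_apply, Kernel.deterministic_apply, Measure.dirac_prod,
      Measure.map_map hj measurable_prodMk_left]
    rfl
  have hη (s : I) (φ : L0 𝒢 P A) : η (s, φ) = P.map fun ω => j (s, ω) := by
    change ((Kernel.deterministic Prod.fst measurable_fst) ×ₖ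
      (Kernel.const _ P)).map j (s, φ) = _
    rw [Kernel.map_apply _ hj, Kernel.prod_apply, Kernel.deterministic_apply, Measure.dirac_prod,
      Measure.map_map hj measurable_prodMk_left]
    rfl
  have : IsFiniteKernel κ := inferInstanceAs (IsFiniteKernel (Kernel.map _ _))
  have : IsFiniteKernel η := inferInstanceAs (IsFiniteKernel (Kernel.map _ _))
  have hjs (s : I) : Measurable fun ω => j (s, ω) := hj.comp measurable_prodMk_left
  have hdens (s : I) (φ : L0 𝒢 P A) {h : Γ → ℝ≥0∞} (hh : Measurable h)
      (hfφ : (fun ω => f (φ.1 ω)) =ᵐ[P] fun ω => h (j (s, ω))) :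
      κ (s, φ) = (η (s, φ)).withDensity h := by
    rw [hκ, hη, withDensity_congr_ae hfφ]
    ext D hD
    rw [withDensity_apply _ hD, Measure.map_apply (hjs s) hD, withDensity_apply _ (hjs s hD),
      setLIntegral_map hD hh (hjs s)]
  -- The time parameter of the kernels is read off the point of `Γ` by `p`; countable generation of
  -- `Γ` enters through the joint measurability of `rnDeriv`.
  refine ⟨fun x => g (κ.rnDeriv η (p x.2, x.1) x.2), ?_, fun s 𝒢' hs φ hφ => ?_⟩
  · exact hgm.comp ((Kernel.measurable_rnDeriv κ η).comp
      (((hp.comp measurable_snd).prodMk measurable_fst).prodMk measurable_snd))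
  · obtain ⟨ψ, hψ, hφψ⟩ := hφ
    obtain ⟨h, hh, hfh⟩ := exists_measurable_comp_ae_eq hs (hf.comp hψ.measurable)
    have hfφ : (fun ω => f (φ.1 ω)) =ᵐ[P] fun ω => h (j (s, ω)) := by
      filter_upwards [hfh, hφψ] with ω h1 h2
      simpa [h2] using h1
    have h2 : κ.rnDeriv η (s, φ) =ᵐ[η (s, φ)] h := by
      refine Kernel.rnDeriv_eq_rnDeriv_measure.trans ?_
      rw [hdens s φ hh hfφ]
      exact Measure.rnDeriv_withDensity _ hh
    rw [hη] at h2
    filter_upwards [ae_of_ae_map (hjs s).aemeasurable h2, hfφ] with ω h3 h4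
    rw [hpj, h3, ← h4]
    exact (congrFun hg (φ.1 ω)).symm

/-! ### Measurability of `L⁰`-valued section maps. -/

namespace L0

variable {Ω : Type*} {𝒢 : MeasurableSpace Ω} {mΩ : MeasurableSpace Ω} {P : Measure Ω}
  {A : Type*}

lemma ext_ae [TopologicalSpace A] {φ ψ : L0 𝒢 P A} (h : φ.1 =ᵐ[P] ψ.1) : φ = ψ :=
  Subtype.ext (AEEqFun.ext h)

/-- The class of an almost everywhere `𝒢`-measurable function. -/
noncomputable def mk [TopologicalSpace A] (h𝒢 : 𝒢 ≤ mΩ) (f : Ω → A)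
    (hf : AEStronglyMeasurable[𝒢] f P) : L0 𝒢 P A :=
  ⟨AEEqFun.mk f (hf.mono h𝒢), hf.congr (AEEqFun.coeFn_mk f _).symm⟩

lemma coe_mk [TopologicalSpace A] (h𝒢 : 𝒢 ≤ mΩ) (f : Ω → A)
    (hf : AEStronglyMeasurable[𝒢] f P) : (mk h𝒢 f hf).1 =ᵐ[P] f :=
  AEEqFun.coeFn_mk f _

open scoped Classical in
lemma exists_piecewise [TopologicalSpace A] (h𝒢 : 𝒢 ≤ mΩ) {D : Set Ω} (hD : MeasurableSet[𝒢] D)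
    (φ ψ : L0 𝒢 P A) :
    ∃ χ : L0 𝒢 P A, χ.1 =ᵐ[P] fun ω => if ω ∈ D then φ.1 ω else ψ.1 ω := by
  obtain ⟨f, hf, hφf⟩ := φ.2
  obtain ⟨g, hg, hψg⟩ := ψ.2
  refine ⟨mk h𝒢 (D.piecewise f g)
    (StronglyMeasurable.aestronglyMeasurable (hf.piecewise hD hg)), ?_⟩
  filter_upwards [coe_mk h𝒢 (D.piecewise f g)
    (StronglyMeasurable.aestronglyMeasurable (hf.piecewise hD hg)), hφf, hψg] with ω h1 h2 h3
  rw [h1, h2, h3]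
  rfl

variable [MetricSpace A]

lemma edist_eq_of_ae {φ ψ : L0 𝒢 P A} {f g : Ω → A} (hf : φ.1 =ᵐ[P] f) (hg : ψ.1 =ᵐ[P] g) :
    edist φ ψ = ∫⁻ ω, edist (f ω) (g ω) ∂P := by
  rw [edist_def]
  refine lintegral_congr_ae ?_
  filter_upwards [hf, hg] with ω h1 h2
  rw [h1, h2]

open scoped Classical in
/-- Gluing along a fixed set is continuous. -/
lemma continuous_of_ae_eq_ite {D : Set Ω} {F : L0 𝒢 P A × L0 𝒢 P A → L0 𝒢 P A}
    (hF : ∀ x, (F x).1 =ᵐ[P] fun ω => if ω ∈ D then x.1.1 ω else x.2.1 ω) :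
    Continuous F := by
  have : LipschitzWith 2 F := fun x y => by
    rw [edist_eq_of_ae (hF x) (hF y)]
    calc ∫⁻ ω, edist (if ω ∈ D then x.1.1 ω else x.2.1 ω) (if ω ∈ D then y.1.1 ω else y.2.1 ω) ∂P
        ≤ ∫⁻ ω, (edist (x.1.1 ω) (y.1.1 ω) + edist (x.2.1 ω) (y.2.1 ω)) ∂P := by
          refine lintegral_mono fun ω => ?_
          by_cases h : ω ∈ D <;> simp [h]
      _ = edist x.1 y.1 + edist x.2 y.2 :=
          lintegral_add_left' (x.1.1.aestronglyMeasurable.edist y.1.1.aestronglyMeasurable) _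
      _ ≤ edist x y + edist x y := add_le_add (le_max_left _ _) (le_max_right _ _)
      _ = _ := by rw [← two_mul]; rfl
  exact this.continuous

/-- Pointwise convergence implies convergence in `L⁰` when the metric is bounded. -/
lemma tendsto_of_ae [IsFiniteMeasure P] (hρ : ∀ a b : A, dist a b < 1) {φ : ℕ → L0 𝒢 P A}
    {ψ : L0 𝒢 P A} {f : ℕ → Ω → A} {g : Ω → A} (hf : ∀ n, (φ n).1 =ᵐ[P] f n)
    (hg : ψ.1 =ᵐ[P] g) (h : ∀ ω, Tendsto (fun n => f n ω) atTop (𝓝 (g ω))) :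
    Tendsto φ atTop (𝓝 ψ) := by
  rw [tendsto_iff_edist_tendsto_0]
  have hlim : Tendsto (fun n => ∫⁻ ω, edist ((φ n).1 ω) (ψ.1 ω) ∂P) atTop
      (𝓝 (∫⁻ _, 0 ∂P)) := by
    refine tendsto_lintegral_of_dominated_convergence' (fun _ => 1)
      (fun n => (φ n).1.aestronglyMeasurable.edist ψ.1.aestronglyMeasurable)
      (fun n => ae_of_all _ fun ω => ?_) (by simp) ?_
    · refine (edist_dist _ _).trans_le ?_
      exact (ENNReal.ofReal_le_ofReal (hρ _ _).le).trans (by simp)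
    · filter_upwards [ae_all_iff.2 hf, hg] with ω h1 h2
      simp_rw [h1, h2]
      exact tendsto_iff_edist_tendsto_0.1 (h ω)
  rw [lintegral_zero] at hlim
  exact hlim

section

variable {Z Y : Type*} [MeasurableSpace Z] [MeasurableSpace Y] {r : Ω → Y}

-- Induction on `R` from rectangles. All three families are quantified so that complements can
-- exchange `β` and `γ` and unions can be glued one set at a time. Strong measurability lets the
-- pair `(β, γ)` be composed with a continuous map without separability of `L⁰`.
open scoped Classical in
lemma stronglyMeasurable_of_ae_eq_ite [IsFiniteMeasure P] (hρ : ∀ a b : A, dist a b < 1)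
    (h𝒢 : 𝒢 ≤ mΩ) (hr : Measurable[𝒢] r) {R : Set (Z × Y)} (hR : MeasurableSet R) :
    ∀ β γ δ : Z → L0 𝒢 P A, StronglyMeasurable β → StronglyMeasurable γ →
      (∀ z, (δ z).1 =ᵐ[P] fun ω => if (z, r ω) ∈ R then (β z).1 ω else (γ z).1 ω) →
      StronglyMeasurable δ := by
  induction R, hR using MeasurableSpace.induction_on_inter generateFrom_prod.symm
    isPiSystem_prod with
  | empty =>
    intro β γ δ hβ hγ hδ
    have : δ = γ := funext fun z => ext_ae (by simpa using hδ z)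
    rwa [this]
  | basic R hR =>
    obtain ⟨C, hC, D, hD, rfl⟩ := hR
    intro β γ δ hβ hγ hδ
    have hD' : MeasurableSet[𝒢] (r ⁻¹' D) := hr hD
    choose F hF using fun x : L0 𝒢 P A × L0 𝒢 P A => exists_piecewise h𝒢 hD' x.1 x.2
    have hFc : Continuous F := continuous_of_ae_eq_ite hF
    have : δ = C.piecewise (fun z => F (β z, γ z)) γ := by
      funext z
      refine ext_ae ?_
      by_cases hz : z ∈ C
      · filter_upwards [hδ z, hF (β z, γ z)] with ω h1 h2
        simp [h1, hz, h2]
      · filter_upwards [hδ z] with ω h1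
        simp [h1, hz]
    rw [this]
    exact (hFc.comp_stronglyMeasurable (hβ.prodMk hγ)).piecewise hC hγ
  | compl R hR ih =>
    intro β γ δ hβ hγ hδ
    refine ih γ β δ hγ hβ fun z => ?_
    filter_upwards [hδ z] with ω h
    rw [h]
    by_cases hz : (z, r ω) ∈ R <;> simp [hz]
  | iUnion R _ hR ih =>
    intro β γ δ hβ hγ hδ
    have hsec (n : ℕ) (z : Z) : MeasurableSet[𝒢] {ω | (z, r ω) ∈ R n} :=
      hr (measurable_prodMk_left (x := z) (hR n))
    choose F hF using fun (n : ℕ) (z : Z) (ψ : L0 𝒢 P A) =>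
      exists_piecewise h𝒢 (hsec n z) (β z) ψ
    -- `ε n` takes the value `β` on the first `n` sets and `γ` elsewhere. At each point this is
    -- eventually constant, and the bound on the metric turns pointwise convergence into convergence
    -- in `L⁰`.
    let ε : ℕ → Z → L0 𝒢 P A := fun n => Nat.rec γ (fun n δ' z => F n z (δ' z)) n
    have hε (n : ℕ) : StronglyMeasurable (ε n) := by
      induction n with
      | zero => exact hγ
      | succ n hn => exact ih n β (ε n) (ε (n + 1)) hβ hn fun z => hF n z (ε n z)
    have hεe (n : ℕ) (z : Z) : (ε n z).1 =ᵐ[P]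
        fun ω => if ∃ k < n, (z, r ω) ∈ R k then (β z).1 ω else (γ z).1 ω := by
      induction n with
      | zero => simp [ε]
      | succ n hn =>
        filter_upwards [hn, hF n z (ε n z)] with ω h1 h2
        change (F n z (ε n z)).1 ω = _
        rw [h2, h1]
        by_cases hz : (z, r ω) ∈ R n
        · have : ∃ k < n + 1, (z, r ω) ∈ R k := ⟨n, n.lt_succ_self, hz⟩
          simp only [hz, this, if_true]
        · have : (∃ k < n + 1, (z, r ω) ∈ R k) ↔ ∃ k < n, (z, r ω) ∈ R k := by
            constructor
            · rintro ⟨k, hk, h⟩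
              refine ⟨k, lt_of_le_of_ne (Nat.lt_succ_iff.1 hk) ?_, h⟩
              rintro rfl
              exact hz h
            · rintro ⟨k, hk, h⟩
              exact ⟨k, hk.trans n.lt_succ_self, h⟩
          simp only [hz, this, if_false]
    refine stronglyMeasurable_of_tendsto atTop hε (tendsto_pi_nhds.2 fun z => ?_)
    refine tendsto_of_ae hρ (fun n => hεe n z) (hδ z) fun ω => ?_
    refine tendsto_const_nhds.congr' ?_
    by_cases hz : ∃ k, (z, r ω) ∈ R k
    · obtain ⟨k, hk⟩ := hz
      filter_upwards [eventually_gt_atTop k] with n hn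
      have h1 : ∃ k < n, (z, r ω) ∈ R k := ⟨k, hn, hk⟩
      have h2 : (z, r ω) ∈ ⋃ i, R i := Set.mem_iUnion.2 ⟨k, hk⟩
      simp only [h1, h2, if_true]
    · refine Eventually.of_forall fun n => ?_
      have h1 : ¬ ∃ k < n, (z, r ω) ∈ R k := fun ⟨k, _, h⟩ => hz ⟨k, h⟩
      have h2 : (z, r ω) ∉ ⋃ i, R i := fun h => hz (Set.mem_iUnion.1 h)
      simp only [h1, h2, if_false]

/-- The classes of the sections of a jointly measurable function form a strongly measurable
family in `L⁰`. -/
theorem stronglyMeasurable_of_ae_eq_section [IsFiniteMeasure P] [Nonempty A]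
    (hρ : ∀ a b : A, dist a b < 1) (h𝒢 : 𝒢 ≤ mΩ) (hr : Measurable[𝒢] r) {Φ : Z × Y → A}
    (hΦ : StronglyMeasurable Φ) {β : Z → L0 𝒢 P A}
    (hβ : ∀ z, (β z).1 =ᵐ[P] fun ω => Φ (z, r ω)) :
    StronglyMeasurable β := by
  classical
  have hrep (Φ : Z × Y → A) (hΦ : StronglyMeasurable Φ) :
      ∃ β : Z → L0 𝒢 P A, ∀ z, (β z).1 =ᵐ[P] fun ω => Φ (z, r ω) :=
    ⟨fun z => mk h𝒢 _ (StronglyMeasurable.aestronglyMeasurable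
      ((hΦ.comp_measurable measurable_prodMk_left).comp_measurable hr)), fun z => coe_mk _ _ _⟩
  have hsimple (f : SimpleFunc (Z × Y) A) : ∀ β : Z → L0 𝒢 P A,
      (∀ z, (β z).1 =ᵐ[P] fun ω => f (z, r ω)) → StronglyMeasurable β := by
    induction f using SimpleFunc.induction' with
    | const c =>
      intro β hβ
      rcases isEmpty_or_nonempty Z with hZ | ⟨⟨z₀⟩⟩
      · exact StronglyMeasurable.of_subsingleton_dom
      · have : β = fun _ => β z₀ := funext fun z => ext_ae ((hβ z).trans (hβ z₀).symm)
        rw [this]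
        exact stronglyMeasurable_const
    | @pcw f g s hs hf hg =>
      intro β hβ
      obtain ⟨βf, hβf⟩ := hrep f f.stronglyMeasurable
      obtain ⟨βg, hβg⟩ := hrep g g.stronglyMeasurable
      refine stronglyMeasurable_of_ae_eq_ite hρ h𝒢 hr hs βf βg β (hf βf hβf) (hg βg hβg)
        fun z => ?_
      filter_upwards [hβ z, hβf z, hβg z] with ω h1 h2 h3
      rw [h1, h2, h3, SimpleFunc.piecewise_apply]
  choose βn hβn using fun n => hrep (hΦ.approx n) (hΦ.approx n).stronglyMeasurable
  refine stronglyMeasurable_of_tendsto atTop (fun n => hsimple _ (βn n) (hβn n))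
    (tendsto_pi_nhds.2 fun z => ?_)
  exact tendsto_of_ae hρ (fun n => hβn n z) (hβ z) fun ω => hΦ.tendsto_approx _

end

end L0

/-! ### Predictable `σ`-algebras of joins, pullbacks and products. -/

section Predictable

variable {ι Ω Ω' X E : Type*} {mΩ : MeasurableSpace Ω} {mΩ' : MeasurableSpace Ω'}
  {mX : MeasurableSpace X}

/-- Complements are taken inside the strip `J × Ω`, itself covered by `h₁`. Hence predictability for
a join of filtrations can be tested on each filtration separately. -/
lemma measurableSet_preimage_prod_of_sup {m₁ m₂ : MeasurableSpace Ω} {f : X → ι × Ω}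
    {J : Set ι} (h₁ : ∀ C, MeasurableSet[m₁] C → MeasurableSet (f ⁻¹' (J ×ˢ C)))
    (h₂ : ∀ C, MeasurableSet[m₂] C → MeasurableSet (f ⁻¹' (J ×ˢ C))) {C : Set Ω}
    (hC : MeasurableSet[m₁ ⊔ m₂] C) : MeasurableSet (f ⁻¹' (J ×ˢ C)) := by
  replace hC := MeasurableSpace.measurableSet_sup.1 hC
  induction hC with
  | basic C hC => exact hC.elim (h₁ C) (h₂ C)
  | empty => simp
  | compl C _ ih =>
    have : f ⁻¹' (J ×ˢ Cᶜ) = f ⁻¹' (J ×ˢ Set.univ) \ f ⁻¹' (J ×ˢ C) := by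
      ext x
      simp only [Set.mem_preimage, Set.mem_prod, Set.mem_compl_iff, Set.mem_sdiff, Set.mem_univ]
      tauto
    rw [this]
    exact (h₁ _ MeasurableSet.univ).diff ih
  | iUnion C _ ih =>
    rw [Set.prod_iUnion, Set.preimage_iUnion]
    exact MeasurableSet.iUnion ih

section Preorder

variable [Preorder ι]

lemma prodFiltration_eq (𝔽 : Filtration ι mΩ) (ℍ : Filtration ι mΩ') :
    prodFiltration 𝔽 ℍ =
      pullback Prod.fst measurable_fst 𝔽 ⊔ pullback Prod.snd measurable_snd ℍ := rfl

lemma measurable_pullback {π : Ω' → Ω} {hπ : Measurable π} {𝔽 : Filtration ι mΩ} (t : ι) :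
    Measurable[pullback π hπ 𝔽 t, 𝔽 t] π := fun C hC => ⟨C, hC, rfl⟩

lemma pullback_sup {π : Ω' → Ω} {hπ : Measurable π} {𝔽 ℍ : Filtration ι mΩ} :
    pullback π hπ (𝔽 ⊔ ℍ) = pullback π hπ 𝔽 ⊔ pullback π hπ ℍ := by
  ext t : 2
  exact MeasurableSpace.comap_sup

end Preorder

section Order

variable [LinearOrder ι] [OrderBot ι]

lemma measurable_predictable {𝔽 : Filtration ι mΩ} {f : X → ι × Ω}
    (hbot : ∀ C, MeasurableSet[𝔽 ⊥] C → MeasurableSet (f ⁻¹' ({⊥} ×ˢ C)))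
    (hIoi : ∀ t C, MeasurableSet[𝔽 t] C → MeasurableSet (f ⁻¹' (Set.Ioi t ×ˢ C))) :
    Measurable[mX, 𝔽.predictable] f := by
  refine measurable_generateFrom ?_
  rintro - (⟨C, hC, rfl⟩ | ⟨t, C, hC, rfl⟩)
  · exact hbot C hC
  · exact hIoi t C hC

lemma measurable_predictable_map {𝔽 : Filtration ι mΩ} {ℍ : Filtration ι mΩ'} {g : Ω → Ω'}
    (hg : ∀ t, Measurable[𝔽 t, ℍ t] g) :
    Measurable[𝔽.predictable, ℍ.predictable] (Prod.map id g) :=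
  measurable_predictable (mX := 𝔽.predictable)
    (fun _ hC => measurableSet_predictable_singleton_bot_prod (hg ⊥ hC))
    (fun t _ hC => measurableSet_predictable_Ioi_prod (hg t hC))

lemma measurable_predictable_sup {𝔽 ℍ : Filtration ι mΩ} {f : X → ι × Ω}
    (h₁ : Measurable[mX, 𝔽.predictable] f) (h₂ : Measurable[mX, ℍ.predictable] f) :
    Measurable[mX, (𝔽 ⊔ ℍ).predictable] f :=
  measurable_predictable
    (fun _ hC => measurableSet_preimage_prod_of_sup (m₁ := 𝔽 ⊥) (m₂ := ℍ ⊥)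
      (fun _ hC => h₁ (measurableSet_predictable_singleton_bot_prod hC))
      (fun _ hC => h₂ (measurableSet_predictable_singleton_bot_prod hC)) hC)
    (fun t _ hC => measurableSet_preimage_prod_of_sup (m₁ := 𝔽 t) (m₂ := ℍ t)
      (fun _ hC => h₁ (measurableSet_predictable_Ioi_prod hC))
      (fun _ hC => h₂ (measurableSet_predictable_Ioi_prod hC)) hC)

lemma measurable_predictable_pullback {π : Ω' → Ω} {hπ : Measurable π} {𝔽 : Filtration ι mΩ}
    {f : X → ι × Ω'} (h : Measurable[mX, 𝔽.predictable] (Prod.map id π ∘ f)) :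
    Measurable[mX, (pullback π hπ 𝔽).predictable] f := by
  refine measurable_predictable ?_ ?_
  · rintro _ ⟨C, hC, rfl⟩
    exact h (measurableSet_predictable_singleton_bot_prod hC)
  · rintro t _ ⟨C, hC, rfl⟩
    exact h (measurableSet_predictable_Ioi_prod hC)

lemma measurable_predictable_prod {𝔽 : Filtration ι mΩ} {ℍ : Filtration ι mΩ'}
    {f : X → ι × (Ω × Ω')} (h₁ : Measurable[mX, 𝔽.predictable] fun x => ((f x).1, (f x).2.1))
    (h₂ : Measurable[mX, ℍ.predictable] fun x => ((f x).1, (f x).2.2)) :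
    Measurable[mX, (prodFiltration 𝔽 ℍ).predictable] f := by
  rw [prodFiltration_eq]
  exact measurable_predictable_sup (measurable_predictable_pullback h₁)
    (measurable_predictable_pullback h₂)

lemma measurable_predictable_fst {𝔽 : Filtration ι mΩ} {ℍ : Filtration ι mΩ'} :
    Measurable[(prodFiltration 𝔽 ℍ).predictable, 𝔽.predictable]
      (Prod.map id Prod.fst : ι × Ω × Ω' → ι × Ω) :=
  measurable_predictable_map fun t => (measurable_fst : Measurable[(𝔽 t).prod (ℍ t), 𝔽 t] _)

lemma measurable_predictable_snd {𝔽 : Filtration ι mΩ} {ℍ : Filtration ι mΩ'} :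
    Measurable[(prodFiltration 𝔽 ℍ).predictable, ℍ.predictable]
      (Prod.map id Prod.snd : ι × Ω × Ω' → ι × Ω') :=
  measurable_predictable_map fun t => (measurable_snd : Measurable[(𝔽 t).prod (ℍ t), ℍ t] _)

end Order

lemma IsPredictableProcess.isProgressive [LinearOrder ι] [OrderBot ι] [TopologicalSpace ι]
    [MeasurableSpace ι] [OpensMeasurableSpace ι] [OrderClosedTopology ι] [MeasurableSpace E]
    {𝔽 : Filtration ι mΩ} {u : ι → Ω → E} (hu : IsPredictableProcess 𝔽 u) :
    IsProgressive 𝔽 u := fun i =>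
  Measurable.comp hu (measurable_inclusion_predictable (i := i))

/-- The graph of `π` gives a predictable section: the composition of a process that is predictable
for the product filtration with `ω' ↦ (π ω', ω')` is predictable. -/
lemma measurable_graph [LinearOrder ι] [OrderBot ι] {π : Ω' → Ω} {hπ : Measurable π}
    {𝔽 ℍ : Filtration ι mΩ} :
    Measurable[(pullback π hπ (𝔽 ⊔ ℍ)).predictable,
      (prodFiltration 𝔽 (pullback π hπ ℍ)).predictable] fun x => (x.1, (π x.2, x.2)) := by
  refine measurable_predictable_prod ?_ (measurable_predictable_pullback ?_)
  · exact measurable_predictable_map fun t =>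
      (measurable_pullback t).mono le_rfl (le_sup_left : 𝔽 t ≤ 𝔽 t ⊔ ℍ t)
  · exact measurable_predictable_map fun t =>
      (measurable_pullback t).mono le_rfl (le_sup_right : ℍ t ≤ 𝔽 t ⊔ ℍ t)

/-- Both ingredients of the join can be read from the graph: `𝔽` through the first component `π ω'`,
and `ℍ` through `ω'` followed by `π`. This is what lets a control factor through the product space.
-/
lemma predictable_le_comap_graph [LinearOrder ι] [OrderBot ι] {π : Ω' → Ω} {hπ : Measurable π}
    {𝔽 ℍ : Filtration ι mΩ} :
    (pullback π hπ (𝔽 ⊔ ℍ)).predictable ≤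
      MeasurableSpace.comap (fun x : ι × Ω' => (x.1, (π x.2, x.2)))
        (prodFiltration 𝔽 (pullback π hπ ℍ)).predictable := by
  set m := MeasurableSpace.comap (fun x : ι × Ω' => (x.1, (π x.2, x.2)))
        (prodFiltration 𝔽 (pullback π hπ ℍ)).predictable
  have hk : Measurable[m, (prodFiltration 𝔽 (pullback π hπ ℍ)).predictable]
      (fun x : ι × Ω' => (x.1, (π x.2, x.2))) := comap_measurable _
  have hid : Measurable[m, (pullback π hπ (𝔽 ⊔ ℍ)).predictable] (id : ι × Ω' → ι × Ω') := by
    refine measurable_predictable_pullback (mX := m)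
      (measurable_predictable_sup (mX := m) ?_ ?_)
    · exact measurable_predictable_fst.comp hk
    · have h := measurable_predictable_snd.comp hk
      exact (measurable_predictable_map fun t => measurable_pullback t).comp h
  exact fun C hC => hid hC

end Predictable

/-! ### Independence and almost sure properties on the graph of `π`. -/

lemma indep_sup_left {Ω : Type*} {m₁ m₂ m₃ mΩ : MeasurableSpace Ω} {P : Measure Ω}
    [IsProbabilityMeasure P] (h₁ : m₁ ≤ mΩ) (h₂ : m₂ ≤ mΩ) (h₃ : m₃ ≤ mΩ)
    (h : Indep m₁ (m₂ ⊔ m₃) P) (h' : Indep m₂ m₃ P) : Indep (m₁ ⊔ m₂) m₃ P := by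
  rw [Indep_iff] at h h'
  refine IndepSets.indep (p1 := {s | ∃ C D, MeasurableSet[m₁] C ∧ MeasurableSet[m₂] D ∧ s = C ∩ D})
    (p2 := {s | MeasurableSet[m₃] s}) (sup_le h₁ h₂) h₃ ?_ (@isPiSystem_measurableSet _ m₃) ?_
    (@generateFrom_measurableSet _ m₃).symm ?_
  · rintro _ ⟨C, D, hC, hD, rfl⟩ _ ⟨C', D', hC', hD', rfl⟩ -
    exact ⟨C ∩ C', D ∩ D', hC.inter hC', hD.inter hD', Set.inter_inter_inter_comm _ _ _ _⟩
  · refine le_antisymm (sup_le (fun C hC => ?_) (fun D hD => ?_)) (generateFrom_le ?_)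
    · exact measurableSet_generateFrom ⟨C, Set.univ, hC, MeasurableSet.univ, by simp⟩
    · exact measurableSet_generateFrom ⟨Set.univ, D, MeasurableSet.univ, hD, by simp⟩
    · rintro _ ⟨C, D, hC, hD, rfl⟩
      exact MeasurableSet.inter ((le_sup_left : m₁ ≤ m₁ ⊔ m₂) _ hC)
        ((le_sup_right : m₂ ≤ m₁ ⊔ m₂) _ hD)
  · rw [IndepSets_iff]
    rintro _ K ⟨C, D, hC, hD, rfl⟩ hK
    have hD' : MeasurableSet[m₂ ⊔ m₃] D := (le_sup_left : m₂ ≤ m₂ ⊔ m₃) _ hD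
    have hK' : MeasurableSet[m₂ ⊔ m₃] K := (le_sup_right : m₃ ≤ m₂ ⊔ m₃) _ hK
    rw [Set.inter_assoc, h C _ hC (hD'.inter hK'), h' D K hD hK, h C D hC hD', mul_assoc]

lemma indep_comap {Ω Ω' : Type*} {m₁ m₂ mΩ : MeasurableSpace Ω} {mΩ' : MeasurableSpace Ω'}
    {P : Measure Ω} {P' : Measure Ω'} {π : Ω' → Ω} (hπ : MeasurePreserving π P' P)
    (h₁ : m₁ ≤ mΩ) (h₂ : m₂ ≤ mΩ) (h : Indep m₁ m₂ P) :
    Indep (m₁.comap π) (m₂.comap π) P' := by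
  rw [Indep_iff] at h ⊢
  rintro _ _ ⟨C, hC, rfl⟩ ⟨D, hD, rfl⟩
  rw [← Set.preimage_inter, hπ.measure_preimage ((h₁ _ hC).inter (h₂ _ hD)).nullMeasurableSet,
    hπ.measure_preimage (h₁ _ hC).nullMeasurableSet,
    hπ.measure_preimage (h₂ _ hD).nullMeasurableSet, h C D hC hD]

section Graph

/-- If `f` and `g` are independent and `f` has the law of `r`, then almost sure properties of
`(f, g)` can be checked with `f` replaced by an independent copy. -/
lemma ae_prodMk_iff_of_indepFun {Ω Ω' Y Y' : Type*} {mΩ : MeasurableSpace Ω}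
    {mΩ' : MeasurableSpace Ω'} {P : Measure Ω} [IsProbabilityMeasure P] {P' : Measure Ω'}
    [IsProbabilityMeasure P'] {mY : MeasurableSpace Y} {mY' : MeasurableSpace Y'} {f : Ω' → Y}
    {g : Ω' → Y'} {r : Ω → Y} (hf : Measurable f) (hg : Measurable g) (hr : Measurable r)
    (h : IndepFun g f P') (hfr : P'.map f = P.map r) {N : Set (Y × Y')} (hN : MeasurableSet N) :
    (∀ᵐ ω' ∂P', (f ω', g ω') ∈ N) ↔ ∀ᵐ ω' ∂P', ∀ᵐ ω ∂P, (r ω, g ω') ∈ N := by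
  have : IsProbabilityMeasure (P.map r) := Measure.isProbabilityMeasure_map hr.aemeasurable
  have hlaw := (indepFun_iff_map_prod_eq_prod_map_map hg.aemeasurable hf.aemeasurable).1 h
  have hN' : MeasurableSet {x : Y' × Y | (x.2, x.1) ∈ N} := measurable_swap hN
  have hNs : MeasurableSet {y | ∀ᵐ x ∂P.map r, (x, y) ∈ N} := by
    simp_rw [ae_iff]
    have : MeasurableSet {x : Y' × Y | (x.2, x.1) ∉ N} := hN'.compl
    exact measurable_measure_prodMk_left this (measurableSet_singleton 0)
  calc (∀ᵐ ω' ∂P', (f ω', g ω') ∈ N)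
      ↔ ∀ᵐ x ∂P'.map fun ω' => (g ω', f ω'), (x.2, x.1) ∈ N :=
        (ae_map_iff (hg.prodMk hf).aemeasurable hN').symm
    _ ↔ ∀ᵐ y ∂P'.map g, ∀ᵐ x ∂P.map r, (x, y) ∈ N := by
        rw [hlaw, hfr, Measure.ae_prod_iff_ae_ae hN']
    _ ↔ ∀ᵐ ω' ∂P', ∀ᵐ x ∂P.map r, (x, g ω') ∈ N := ae_map_iff hg.aemeasurable hNs
    _ ↔ _ := by
        refine eventually_congr (ae_of_all _ fun ω' => ?_)
        exact ae_map_iff hr.aemeasurable (measurable_prodMk_right hN)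

lemma ae_graph_iff_of_indep {Ω Ω' : Type*} {m mΩ : MeasurableSpace Ω}
    {m' mΩ' : MeasurableSpace Ω'} {P : Measure Ω} [IsProbabilityMeasure P] {P' : Measure Ω'}
    [IsProbabilityMeasure P'] {π : Ω' → Ω} (hπ : MeasurePreserving π P' P) (hm : m ≤ mΩ)
    (hm' : m' ≤ mΩ') (h : Indep m' (m.comap π) P') {N : Set (Ω × Ω')}
    (hN : MeasurableSet[m.prod m'] N) :
    (∀ᵐ ω' ∂P', (π ω', ω') ∈ N) ↔ ∀ᵐ ω' ∂P', ∀ᵐ ω ∂P, (ω, ω') ∈ N := by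
  have hid : @Measurable _ _ mΩ m id := measurable_id'' hm
  have hπm : @Measurable _ _ mΩ' m π := hπ.measurable.mono le_rfl hm
  -- The targets carry the smaller `σ`-algebras `m` and `m'`; only for these are `π` and the
  -- identity of `Ω'` independent random variables.
  refine ae_prodMk_iff_of_indepFun (mY := m) (mY' := m') (f := π) (g := id) (r := id)
    hπm (measurable_id'' hm') hid ?_ ?_ hN
  · refine (IndepFun_iff_Indep (mβ := m') (mγ := m) id π P').2 ?_
    rw [MeasurableSpace.comap_id]
    exact h
  · refine @Measure.ext _ m _ _ fun C hC => ?_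
    rw [@Measure.map_apply _ _ mΩ' m _ _ hπm _ hC, @Measure.map_apply _ _ mΩ m _ _ hid _ hC]
    exact hπ.measure_preimage (hm _ hC).nullMeasurableSet

end Graph

/-! ### A countably generated substitute for the predictable `σ`-algebra. -/

namespace Setting

variable {Ω Ω' : Type*} {mΩ : MeasurableSpace Ω} {mΩ' : MeasurableSpace Ω'}
  {P : Measure Ω} {P' : Measure Ω'} {T : ℝ≥0} {m n : ℕ}

lemma filtGW_apply (S : Setting P T m n) (s : TimeInterval T) :
    S.filtGW s = S.G ⊔ S.brownian_W.filtration s := rfl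

lemma G_le_filtGW (S : Setting P T m n) (s : TimeInterval T) : S.G ≤ S.filtGW s :=
  (le_sup_left : S.G ≤ S.G ⊔ S.brownian_W.filtration s)

lemma measurable_W (S : Setting P T m n) {r s : TimeInterval T} (hrs : r ≤ s) :
    Measurable[S.filtGW s] (S.W r) := by
  have h : Measurable[S.brownian_W.filtration r] (S.W r) :=
    Measurable.mono (comap_measurable _) (le_iSup₂_of_le r le_rfl le_rfl) le_rfl
  exact h.mono ((S.brownian_W.filtration.mono hrs).trans
    (le_sup_right : S.brownian_W.filtration s ≤ S.G ⊔ S.brownian_W.filtration s)) le_rfl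

/-- The path of `W` strictly before the current time, along a countable dense set of times. -/
noncomputable def pastNoise (S : Setting P T m n) (x : TimeInterval T × Ω) : ℕ → Fin m → ℝ :=
  fun k => if TopologicalSpace.denseSeq (TimeInterval T) k < x.1 then
    S.W (TopologicalSpace.denseSeq (TimeInterval T) k) x.2 else 0

/-- The countably generated `σ`-algebra on `[0,T] × Ω` generated by the time, by `𝒢`, and by
`pastNoise`. -/
@[reducible]
noncomputable def strictPast (S : Setting P T m n) : MeasurableSpace (TimeInterval T × Ω) :=
  MeasurableSpace.comap Prod.fst Subtype.instMeasurableSpace ⊔ S.G.comap Prod.snd ⊔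
    MeasurableSpace.comap S.pastNoise MeasurableSpace.pi

lemma countablyGenerated_strictPast (S : Setting P T m n) :
    @CountablyGenerated _ S.strictPast := by
  have h₁ := CountablyGenerated.comap (Prod.fst : TimeInterval T × Ω → TimeInterval T)
  have h₂ := @CountablyGenerated.comap _ _ S.G S.G_separable
    (Prod.snd : TimeInterval T × Ω → Ω)
  have h₃ := CountablyGenerated.comap S.pastNoise
  exact (h₁.sup h₂).sup h₃

lemma measurable_fst_strictPast (S : Setting P T m n) :
    Measurable[S.strictPast] (Prod.fst : TimeInterval T × Ω → TimeInterval T) :=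
  fun C hC => (le_sup_left.trans le_sup_left : _ ≤ S.strictPast) _ ⟨C, hC, rfl⟩

lemma measurable_snd_strictPast (S : Setting P T m n) :
    Measurable[S.strictPast, S.G] (Prod.snd : TimeInterval T × Ω → Ω) :=
  fun C hC => (le_sup_right.trans le_sup_left : _ ≤ S.strictPast) _ ⟨C, hC, rfl⟩

lemma measurable_pastNoise (S : Setting P T m n) : Measurable[S.strictPast] S.pastNoise :=
  fun C hC => (le_sup_right : _ ≤ S.strictPast) _ ⟨C, hC, rfl⟩

/-- The strict inequality in `pastNoise` matters here: `W_q` is used only on `(q, T]`, which gives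
generating predictable rectangles. -/
lemma strictPast_le_predictable (S : Setting P T m n) :
    S.strictPast ≤ S.filtGW.predictable := by
  have hIoi (t : TimeInterval T) : MeasurableSet[S.filtGW.predictable]
      {x : TimeInterval T × Ω | t < x.1} := by
    have := measurableSet_predictable_Ioi_prod (𝓕 := S.filtGW) (i := t)
      (@MeasurableSet.univ _ (S.filtGW t))
    convert this using 1
    ext x
    simp
  refine sup_le (sup_le ?_ ?_) ?_
  · rw [← measurable_iff_comap_le]
    exact measurable_of_Ioi fun t => hIoi t
  · rintro _ ⟨C, hC, rfl⟩
    have : (Prod.snd ⁻¹' C : Set (TimeInterval T × Ω)) = {⊥} ×ˢ C ∪ Set.Ioi ⊥ ×ˢ C := by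
      ext x
      rcases eq_bot_or_bot_lt x.1 with h | h
      · simp [h]
      · simp [h, h.ne']
    rw [this]
    exact MeasurableSet.union
      (measurableSet_predictable_singleton_bot_prod (S.G_le_filtGW ⊥ _ hC))
      (measurableSet_predictable_Ioi_prod (S.G_le_filtGW ⊥ _ hC))
  · rw [← measurable_iff_comap_le]
    refine @measurable_pi_lambda _ _ _ S.filtGW.predictable _ _ fun k => ?_
    set q := TopologicalSpace.denseSeq (TimeInterval T) k
    intro D hD
    have : (fun x => S.pastNoise x k) ⁻¹' D = Set.Ioi q ×ˢ (S.W q ⁻¹' D) ∪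
        ({x : TimeInterval T × Ω | q < x.1}ᶜ ∩ {_x | (0 : Fin m → ℝ) ∈ D}) := by
      ext x
      by_cases h : q < x.1 <;> simp [pastNoise, q, h]
    rw [this]
    exact MeasurableSet.union
      (measurableSet_predictable_Ioi_prod (S.measurable_W le_rfl hD))
      ((hIoi q).compl.inter (MeasurableSet.const _))

lemma predictable_le_prod (𝔽 : Filtration (TimeInterval T) mΩ) :
    𝔽.predictable ≤ MeasurableSpace.prod Subtype.instMeasurableSpace mΩ :=
  measurableSpace_le_predictable_of_measurableSet
    (fun _ hC => (measurableSet_singleton _).prod (𝔽.le _ _ hC))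
    (fun _ _ hC => measurableSet_Ioi.prod (𝔽.le _ _ hC))

/-- By continuity of `W`, the past up to `s` coincides with the strict past of `s` up to null
sets. -/
lemma exists_strictPast_ae_eq (S : Setting P T m n) (s : TimeInterval T) {C : Set Ω}
    (hC : MeasurableSet[S.filtGW s] C) :
    ∃ D, MeasurableSet[S.strictPast] D ∧ C =ᵐ[P] (fun ω => (s, ω)) ⁻¹' D := by
  let g : Ω → TimeInterval T × Ω := fun ω => (s, ω)
  let m₀ : MeasurableSpace Ω := S.strictPast.comap g
  have hg : Measurable[m₀, S.strictPast] g := comap_measurable _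
  suffices h : S.filtGW s ≤ eventuallyMeasurableSpace m₀ (ae P) by
    obtain ⟨_, ⟨D, hD, rfl⟩, hCD⟩ := h C hC
    exact ⟨D, hD, hCD⟩
  rw [filtGW_apply]
  refine sup_le ?_ (iSup₂_le fun r hr => ?_)
  · have : Measurable[m₀, S.G] (id : Ω → Ω) := S.measurable_snd_strictPast.comp hg
    exact le_trans (fun C hC => this hC) le_eventuallyMeasurableSpace
  · rw [← measurable_iff_comap_le]
    suffices h : ∃ V : Ω → Fin m → ℝ, Measurable[m₀] V ∧ S.W r =ᵐ[P] V by
      obtain ⟨V, hV, hWV⟩ := h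
      exact hV.eventuallyMeasurable_of_eventuallyEq hWV
    -- Time `0` has no strict past; there `W` vanishes almost surely.
    rcases eq_bot_or_bot_lt s with rfl | hs
    · obtain rfl : r = ⊥ := le_bot_iff.1 hr
      exact ⟨fun _ => 0, measurable_const, S.brownian_W.start_zero⟩
    -- For `s > 0`, every `r ≤ s`, including `r = s`, is a limit of times of the dense sequence
    -- strictly before `s`.
    · have hcl : r ∈ closure (Set.Iio s ∩
          Set.range (TopologicalSpace.denseSeq (TimeInterval T))) := by
        have hr' : r ∈ closure (Set.Iio s) := by
          rw [closure_Iio' (α := TimeInterval T) (a := s) ⟨⊥, hs⟩]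
          exact hr
        exact closure_minimal ((TopologicalSpace.denseRange_denseSeq _).open_subset_closure_inter
          isOpen_Iio) isClosed_closure hr'
      obtain ⟨q, hq, hqr⟩ := mem_closure_iff_seq_limit.1 hcl
      choose k hk using fun i => (hq i).2
      have hqW (i : ℕ) : Measurable[m₀] (S.W (q i)) := by
        have h : Measurable[m₀] fun ω => S.pastNoise (g ω) (k i) :=
          (measurable_pi_apply (k i)).comp (S.measurable_pastNoise.comp hg)
        convert h using 1
        funext ω
        have hlt : q i < s := (hq i).1
        simp [pastNoise, g, hk, hlt]
      -- The limit is measurable everywhere, with a default value where it does not exist; it equals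
      -- `W_r` on continuous paths.
      refine ⟨fun ω => limUnder atTop fun i => S.W (q i) ω,
        (StronglyMeasurable.limUnder fun i => (hqW i).stronglyMeasurable).measurable, ?_⟩
      filter_upwards [S.brownian_W.continuous_paths] with ω hω
      exact (((hω.tendsto r).comp hqr).limUnder_eq).symm

end Setting

/-! ### Construction of the identified controls and uniqueness up to modification. -/

namespace Setting

variable {Ω Ω' A : Type*} {mΩ : MeasurableSpace Ω} {mΩ' : MeasurableSpace Ω'}
  {P : Measure Ω} {P' : Measure Ω'} {π : Ω' → Ω} {T : ℝ≥0} {m n : ℕ}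

lemma indep_filtGW_filtB [IsProbabilityMeasure P] (S : Setting P T m n) :
    Indep (S.filtGW ⊤) (S.filtB ⊤) P :=
  indep_sup_left S.G_le (S.brownian_W.filtration.le ⊤) (S.brownian_B.filtration.le ⊤)
    S.indep_G S.indep_W_B

lemma indep_pullback [IsProbabilityMeasure P] (S : Setting P T m n)
    (hπ : MeasurePreserving π P' P) :
    Indep (pullback π hπ.measurable S.filtB ⊤) (pullback π hπ.measurable S.filtGW ⊤) P' :=
  indep_comap hπ (S.filtB.le ⊤) (S.filtGW.le ⊤) S.indep_filtGW_filtB.symm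

lemma mem_controls_of_graph [MeasurableSpace A] (S : Setting P T m n)
    (hπ : MeasurePreserving π P' P)
    {Φ : TimeInterval T → Ω × Ω' → A}
    (hΦ : IsPredictableProcess
      (prodFiltration S.filtGW (pullback π hπ.measurable S.filtB)) Φ) :
    (fun s ω' => Φ s (π ω', ω')) ∈ S.controls π hπ.measurable A :=
  Measurable.comp (g := Function.uncurry Φ) hΦ measurable_graph

variable [MetricSpace A] [MeasurableSpace A]

lemma identifies_of_predictable [IsProbabilityMeasure P] (S : Setting P T m n)
    (hπ : MeasurePreserving π P' P) {α : TimeInterval T → Ω' → A}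
    {β : TimeInterval T → Ω' → S.ActionSpace A} {Φ : TimeInterval T → Ω × Ω' → A}
    (hα : α ∈ S.controls π hπ.measurable A)
    (hβ : β ∈ S.reformulatedControls π hπ.measurable A)
    (hΦ : IsPredictableProcess
      (prodFiltration S.filtGW (pullback π hπ.measurable S.filtB)) Φ)
    (hαΦ : ∀ s ω', α s ω' = Φ s (π ω', ω'))
    (hβΦ : ∀ s ω', (β s ω').1 =ᵐ[P] fun ω => Φ s (ω, ω')) :
    S.Identifies π hπ.measurable P' (pullback π hπ.measurable S.filtB) α β where
  indep := S.indep_pullback hπ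
  progressive_left := by
    rw [← pullback_sup]
    exact IsPredictableProcess.isProgressive hα
  progressive_right := IsPredictableProcess.isProgressive hβ.1
  exists_common := ⟨Φ, hΦ.isProgressive, hαΦ, hβΦ⟩

variable [BorelSpace A]

theorem exists_control_identifies [IsProbabilityMeasure P] [PolishSpace A] [Nonempty A]
    (S : Setting P T m n) (hπ : MeasurePreserving π P' P)
    {β : TimeInterval T → Ω' → S.ActionSpace A}
    (hβ : β ∈ S.reformulatedControls π hπ.measurable A) :
    ∃ α ∈ S.controls π hπ.measurable A,
      S.Identifies π hπ.measurable P' (pullback π hπ.measurable S.filtB) α β := by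
  obtain ⟨Ψ, hΨ, hrep⟩ := @exists_measurable_representative (TimeInterval T) Ω
    (TimeInterval T × Ω) A _ (S.filtGW ⊤) mΩ P _ S.strictPast S.countablyGenerated_strictPast
    _ _ _ _ _ id (measurable_id'' (S.strictPast_le_predictable.trans (predictable_le_prod _)))
    Prod.fst S.measurable_fst_strictPast fun _ => rfl
  -- The common noise enters only through `β`, the initial information and `W` only through the
  -- strict past, so `Φ` is predictable for the product filtration.
  let Φ : TimeInterval T → Ω × Ω' → A := fun s x => Ψ (β s x.2, (s, x.1))
  have hΦ : IsPredictableProcess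
      (prodFiltration S.filtGW (pullback π hπ.measurable S.filtB)) Φ := by
    have h₁ := Measurable.comp (g := Function.uncurry β) hβ.1
      (measurable_predictable_snd (𝔽 := S.filtGW))
    have h₂ := (measurable_predictable_fst (𝔽 := S.filtGW)
      (ℍ := pullback π hπ.measurable S.filtB)).mono le_rfl S.strictPast_le_predictable
    exact hΨ.comp (@Measurable.prodMk _ _ _ _ _ S.strictPast _ _ h₁ h₂)
  refine ⟨_, S.mem_controls_of_graph hπ hΦ, S.identifies_of_predictable hπ
    (S.mem_controls_of_graph hπ hΦ) hβ hΦ (fun _ _ => rfl) fun s ω' => ?_⟩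
  exact hrep s (S.filtGW s) (fun C hC => S.exists_strictPast_ae_eq s hC) (β s ω') (hβ.2 s ω')

/-- Adaptedness in `Ω` is relaxed to the terminal `σ`-algebra, so that a predictable `Φ` becomes a
jointly measurable function of a parameter `(t, ω')` and of `ω`, the form needed for section maps
into `L⁰`. -/
lemma measurable_predictable_prod_swap {𝔽 : Filtration (TimeInterval T) mΩ}
    {ℍ : Filtration (TimeInterval T) mΩ'} :
    Measurable[ℍ.predictable.prod (𝔽 ⊤), (prodFiltration 𝔽 ℍ).predictable]
      fun x : (TimeInterval T × Ω') × Ω => (x.1.1, (x.2, x.1.2)) := by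
  have hfst : Measurable[ℍ.predictable.prod (𝔽 ⊤), ℍ.predictable]
      (Prod.fst : (TimeInterval T × Ω') × Ω → TimeInterval T × Ω') :=
    @measurable_fst _ _ ℍ.predictable (𝔽 ⊤)
  have hsnd : Measurable[ℍ.predictable.prod (𝔽 ⊤), 𝔽 ⊤]
      (Prod.snd : (TimeInterval T × Ω') × Ω → Ω) := @measurable_snd _ _ ℍ.predictable (𝔽 ⊤)
  refine measurable_predictable_prod (mX := ℍ.predictable.prod (𝔽 ⊤)) ?_ hfst
  refine measurable_predictable (mX := ℍ.predictable.prod (𝔽 ⊤)) (fun C hC => ?_)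
    (fun t C hC => ?_)
  · have h₁ := hfst (measurableSet_predictable_singleton_bot_prod
      (@MeasurableSet.univ _ (ℍ ⊥)))
    convert h₁.inter (hsnd (𝔽.mono le_top _ hC)) using 1
    ext x
    simp
  · have h₁ := hfst (measurableSet_predictable_Ioi_prod (i := t)
      (@MeasurableSet.univ _ (ℍ t)))
    convert h₁.inter (hsnd (𝔽.mono le_top _ hC)) using 1
    ext x
    simp

theorem exists_reformulatedControl_identifies [IsProbabilityMeasure P] [PolishSpace A]
    [Nonempty A] (hρ : ∀ a b : A, dist a b < 1)
    (S : Setting P T m n) (hπ : MeasurePreserving π P' P)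
    {α : TimeInterval T → Ω' → A} (hα : α ∈ S.controls π hπ.measurable A) :
    ∃ β ∈ S.reformulatedControls π hπ.measurable A,
      S.Identifies π hπ.measurable P' (pullback π hπ.measurable S.filtB) α β := by
  have hα' := Measurable.mono hα predictable_le_comap_graph le_rfl
  obtain ⟨Φ, hΦ, hαΦ⟩ := @Measurable.exists_eq_measurable_comp _ _ _
    (prodFiltration S.filtGW (pullback π hπ.measurable S.filtB)).predictable _ _ _ _ _ hα'
  have hprog : IsProgressive (prodFiltration S.filtGW (pullback π hπ.measurable S.filtB))
      (Function.curry Φ) := IsPredictableProcess.isProgressive hΦ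
  -- Adaptedness of `Φ` at time `s`, not merely at the terminal time, is what places `β s ω'` in
  -- `𝒜_s`.
  have hsec (s : TimeInterval T) (ω' : Ω') :
      StronglyMeasurable[S.filtGW s] fun ω => Φ (s, (ω, ω')) :=
    Measurable.stronglyMeasurable ((hprog.adapted s).comp
      (@measurable_prodMk_right _ _ (S.filtGW s) (pullback π hπ.measurable S.filtB s) ω'))
  have hsec' (s : TimeInterval T) (ω' : Ω') :
      AEStronglyMeasurable[S.filtGW ⊤] (fun ω => Φ (s, (ω, ω'))) P :=
    StronglyMeasurable.aestronglyMeasurable ((hsec s ω').mono (S.filtGW.mono le_top))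
  let β : TimeInterval T → Ω' → S.ActionSpace A := fun s ω' =>
    L0.mk (S.filtGW.le ⊤) (fun ω => Φ (s, (ω, ω'))) (hsec' s ω')
  have hβΦ (s : TimeInterval T) (ω' : Ω') : (β s ω').1 =ᵐ[P] fun ω => Φ (s, (ω, ω')) :=
    L0.coe_mk _ _ _
  have hβ : β ∈ S.reformulatedControls π hπ.measurable A := by
    refine ⟨?_, fun s ω' => ?_⟩
    · have h := @L0.stronglyMeasurable_of_ae_eq_section Ω (S.filtGW ⊤) mΩ P A _
        (TimeInterval T × Ω') Ω (pullback π hπ.measurable S.filtB).predictable (S.filtGW ⊤) id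
        _ _ hρ (S.filtGW.le ⊤) measurable_id
        (fun x => Φ (x.1.1, (x.2, x.1.2)))
        (Measurable.stronglyMeasurable (hΦ.comp measurable_predictable_prod_swap))
        (Function.uncurry β) fun z => hβΦ z.1 z.2
      exact h.measurable
    · exact AEStronglyMeasurable.congr
        (StronglyMeasurable.aestronglyMeasurable (hsec s ω')) (hβΦ s ω').symm
  exact ⟨β, hβ, S.identifies_of_predictable hπ hα hβ (Φ := Function.curry Φ) hΦ
    (fun s ω' => congrFun hαΦ (s, ω')) hβΦ⟩

theorem isModification_iff_of_identifies [IsProbabilityMeasure P] [IsProbabilityMeasure P']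
    [SecondCountableTopology A] (S : Setting P T m n) (hπ : MeasurePreserving π P' P)
    {𝔽 : Filtration (TimeInterval T) mΩ'} {α₁ α₂ : TimeInterval T → Ω' → A}
    {β₁ β₂ : TimeInterval T → Ω' → S.ActionSpace A}
    (h₁ : S.Identifies π hπ.measurable P' 𝔽 α₁ β₁)
    (h₂ : S.Identifies π hπ.measurable P' 𝔽 α₂ β₂) :
    IsModification P' α₁ α₂ ↔ IsModification P' β₁ β₂ := by
  obtain ⟨Φ₁, hΦ₁, hα₁, hβ₁⟩ := h₁.exists_common
  obtain ⟨Φ₂, hΦ₂, hα₂, hβ₂⟩ := h₂.exists_common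
  refine forall_congr' fun s => ?_
  have hN : MeasurableSet[(S.filtGW s).prod (𝔽 s)] {x | Φ₁ s x = Φ₂ s x} :=
    measurableSet_eq_fun (hΦ₁.adapted s) (hΦ₂.adapted s)
  -- The agreement set is moved to the terminal time, where the independence in `Identifies` is
  -- formulated.
  have hN' := (prodFiltration S.filtGW 𝔽).mono (le_top : s ≤ ⊤) _ hN
  have key := ae_graph_iff_of_indep hπ (S.filtGW.le ⊤) (𝔽.le ⊤) h₁.indep hN'
  calc α₁ s =ᵐ[P'] α₂ s ↔ ∀ᵐ ω' ∂P', (π ω', ω') ∈ {x | Φ₁ s x = Φ₂ s x} := by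
        refine eventually_congr (ae_of_all _ fun ω' => ?_)
        rw [hα₁, hα₂]
        rfl
    _ ↔ ∀ᵐ ω' ∂P', ∀ᵐ ω ∂P, (ω, ω') ∈ {x | Φ₁ s x = Φ₂ s x} := key
    _ ↔ β₁ s =ᵐ[P'] β₂ s := by
        refine eventually_congr (ae_of_all _ fun ω' => ?_)
        constructor
        · intro h
          exact L0.ext_ae ((hβ₁ s ω').trans (EventuallyEq.trans h (hβ₂ s ω').symm))
        · intro h
          have h' := hβ₂ s ω'
          rw [← h] at h'
          exact (hβ₁ s ω').symm.trans h'

end Setting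

end MeanFieldControl

theorem mainTheorem6 {Ω Ω' A : Type*} {mΩ : MeasurableSpace Ω} {mΩ' : MeasurableSpace Ω'}
    (P : Measure Ω) [IsProbabilityMeasure P] (P' : Measure Ω') [IsProbabilityMeasure P']
    (π : Ω' → Ω) (hπ : MeasurePreserving π P' P)
    [MetricSpace A] [PolishSpace A] [MeasurableSpace A] [BorelSpace A]
    (hρ : ∀ a b : A, dist a b < 1)
    (T : ℝ≥0) (m n : ℕ) (S : MeanFieldControl.Setting P T m n) :
    -- every reformulated control is identified with an original control
    (∀ β ∈ S.reformulatedControls π hπ.measurable A, ∃ α ∈ S.controls π hπ.measurable A,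
      S.Identifies π hπ.measurable P'
        (MeanFieldControl.pullback π hπ.measurable S.filtB) α β) ∧
    -- every original control is identified with a reformulated control
    (∀ α ∈ S.controls π hπ.measurable A, ∃ β ∈ S.reformulatedControls π hπ.measurable A,
      S.Identifies π hπ.measurable P'
        (MeanFieldControl.pullback π hπ.measurable S.filtB) α β) ∧
    -- the identification is one-to-one up to modification
    (∀ α₁ ∈ S.controls π hπ.measurable A, ∀ α₂ ∈ S.controls π hπ.measurable A,
      ∀ β₁ ∈ S.reformulatedControls π hπ.measurable A,
      ∀ β₂ ∈ S.reformulatedControls π hπ.measurable A,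
      S.Identifies π hπ.measurable P'
        (MeanFieldControl.pullback π hπ.measurable S.filtB) α₁ β₁ →
      S.Identifies π hπ.measurable P'
        (MeanFieldControl.pullback π hπ.measurable S.filtB) α₂ β₂ →
      (MeanFieldControl.IsModification P' α₁ α₂ ↔
        MeanFieldControl.IsModification P' β₁ β₂)) := by
  refine ⟨fun β hβ => ?_, fun α hα => ?_, fun α₁ _ α₂ _ β₁ _ β₂ _ h₁ h₂ =>
    S.isModification_iff_of_identifies hπ h₁ h₂⟩
  -- `A` is nonempty because a given control takes a value on the nonempty probability spaces.
  · obtain ⟨ω⟩ := nonempty_of_isProbabilityMeasure P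
    obtain ⟨ω'⟩ := nonempty_of_isProbabilityMeasure P'
    have : Nonempty A := ⟨(β ⊥ ω').1 ω⟩
    exact S.exists_control_identifies hπ hβ
  · obtain ⟨ω'⟩ := nonempty_of_isProbabilityMeasure P'
    have : Nonempty A := ⟨α ⊥ ω'⟩
    exact S.exists_reformulatedControl_identifies hρ hπ hα
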